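/- Let $\Bbbk$ be a field of characteristic $0$ and let $m,n\ge 1$ be integers. Let $L_{m,n}$ be the lollipop graph: its vertices are $x_1,\dots,x_m,y_1,\dots,y_n$, and its edges are $\{x_i,x_j\}$ for $1\le i<j\le m$, $\{y_i,y_{i+1}\}$ for $1\le i<n$, and the bridge $\{x_m,y_1\}$. Let $$A(L_{m,n})=\frac{\Bbbk[x_1,\dots,x_m,y_1,\dots,y_n]}{(x_1^2,\dots,x_m^2,y_1^2,\dots,y_n^2)+I(L_{m,n})},$$ where $I(L_{m,n})$ is the edge ideal, generated by the products $uv$ over all edges $\{u,v\}$ of $L_{m,n}$, and give it the standard grading $A(L_{m,n})=\bigoplus_{j\ge 0}[A(L_{m,n})]_j$. A standard graded Artinian $\Bbbk$-algebra $A$ has the weak Lefschetz property (WLP) if there is a linear form $\ell\in[A]_1$ such that for every $j$ the multiplication map $\cdot\ell:[A]_j\to[A]_{j+1}$ is injective or surjective. Then $A(L_{m,n})$ has the WLP if and only if one of the following conditions holds: (i) $m=1$ and $n\in\{1,2,3,4,5,6,8,9,12\}$; (ii) $m=2$ and $n\in\{1,2,3,4,5,7,8,11\}$; (iii) $m\ge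 3$ and $n\in\{1,3,4,7\}$. -/

import Mathlib

/-- Multiplication by an element `ℓ` of degree one, as a linear map `[A]_j → [A]_{j+1}` between
consecutive graded pieces of a graded `k`-algebra `A`. -/
def gradedMulMap {k A : Type*} [CommSemiring k] [CommSemiring A] [Algebra k A]
    (𝒜 : ℕ → Submodule k A) [SetLike.GradedMonoid 𝒜] (ℓ : 𝒜 1) (j : ℕ) :
    𝒜 j →ₗ[k] 𝒜 (j + 1) :=
  (LinearMap.mulLeft k (ℓ : A)).restrict fun a ha => by
    have h := SetLike.mul_mem_graded (A := 𝒜) ℓ.2 ha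
    rwa [add_comm] at h

/-- The weak Lefschetz property of a graded algebra: there is a linear form `ℓ ∈ [A]_1` such that
every multiplication map `ℓ : [A]_j → [A]_{j+1}` has maximal rank, i.e. is injective or
surjective. -/
def HasWeakLefschetzProperty {k A : Type*} [CommSemiring k] [CommSemiring A] [Algebra k A]
    (𝒜 : ℕ → Submodule k A) [SetLike.GradedMonoid 𝒜] : Prop :=
  ∃ ℓ : 𝒜 1, ∀ j : ℕ,
    Function.Injective (gradedMulMap 𝒜 ℓ j) ∨ Function.Surjective (gradedMulMap 𝒜 ℓ j)

/-- The standard grading on a quotient `k[V] ⧸ I` of a polynomial ring: the piece of degree `j`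
is the image of the space of homogeneous polynomials of degree `j`. -/
noncomputable def quotientGrading {k V : Type*} [CommRing k] (I : Ideal (MvPolynomial V k))
    (j : ℕ) : Submodule k (MvPolynomial V k ⧸ I) :=
  (MvPolynomial.homogeneousSubmodule V k j).map (Ideal.Quotient.mkₐ k I).toLinearMap

instance quotientGrading.gradedMonoid {k V : Type*} [CommRing k]
    (I : Ideal (MvPolynomial V k)) : SetLike.GradedMonoid (quotientGrading I) where
  one_mem := ⟨1, MvPolynomial.isHomogeneous_one V k, map_one (Ideal.Quotient.mkₐ k I)⟩
  mul_mem := by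
    rintro i j _ _ ⟨a, ha, rfl⟩ ⟨b, hb, rfl⟩
    exact ⟨a * b, MvPolynomial.IsHomogeneous.mul ha hb, map_mul (Ideal.Quotient.mkₐ k I) a b⟩

/-- The edge ideal `I(G) = (x_u x_v ∣ {u, v} ∈ E(G))`. -/
noncomputable def edgeIdeal (k : Type*) [CommRing k] {V : Type*} (G : SimpleGraph V) :
    Ideal (MvPolynomial V k) :=
  Ideal.span {p | ∃ u v : V, G.Adj u v ∧ p = MvPolynomial.X u * MvPolynomial.X v}

/-- The ideal `(x_v ^ 2 ∣ v ∈ V) + I(G)` defining the Artinian algebra of a graph. -/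
noncomputable def graphIdeal (k : Type*) [CommRing k] {V : Type*} (G : SimpleGraph V) :
    Ideal (MvPolynomial V k) :=
  Ideal.span (Set.range fun v : V => (MvPolynomial.X v : MvPolynomial V k) ^ 2) + edgeIdeal k G

/-- The algebra `A(G) = k[x_v ∣ v ∈ V] ⧸ ((x_v ^ 2 ∣ v ∈ V) + I(G))`. -/
abbrev GraphAlgebra (k : Type*) [CommRing k] {V : Type*} (G : SimpleGraph V) : Type _ :=
  MvPolynomial V k ⧸ graphIdeal k G

/-- The standard grading `A(G) = ⨁ [A(G)]_j`. -/
noncomputable abbrev GraphAlgebra.grading (k : Type*) [CommRing k] {V : Type*}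
    (G : SimpleGraph V) : ℕ → Submodule k (GraphAlgebra k G) :=
  quotientGrading (graphIdeal k G)

/-- The lollipop graph `L_{m,n}`, for `m, n ≥ 1`: the disjoint union of the complete graph on
`x_1, …, x_m` and the path `y_1 — ⋯ — y_n`, together with the bridge `{x_m, y_1}`. The vertex
`x_i` is `Sum.inl (i - 1)` and `y_j` is `Sum.inr (j - 1)`. -/
def lollipopGraph (m n : ℕ) : SimpleGraph (Fin m ⊕ Fin n) :=
  ((⊤ : SimpleGraph (Fin m)).sum (SimpleGraph.pathGraph n)) ⊔
    SimpleGraph.fromRel fun u v =>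
      ∃ (i : Fin m) (j : Fin n), (i : ℕ) + 1 = m ∧ (j : ℕ) = 0 ∧ u = Sum.inl i ∧ v = Sum.inr j

/-! The monomials of the independent sets of G form a basis of A(G). In each degree j there are two
sufficient bounds for the sum of the variables and two obstructions valid for every linear form, and
they meet without a gap. With N = m + n, the WLP fails exactly when some j satisfies N ≤ 4j and 3j +
2 ≤ N (for m ≤ 2), or n + 2 ≤ 4j and 3j ≤ n + 1 (for m ≥ 3).

Obstructions. If 2j cliques with vertex sums s_i, t_i partition the graph, then s_i² = t_i² = 0, so
∏ (s_i - t_i) is annihilated by ∑ (s_i + t_i), the sum of the variables. A degeneration passes from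
this form to an arbitrary one (`not_injective_of_sum_var_mul_eq_zero`). Conversely, j + 1 mutually
non-adjacent pairs of vertices give a map to k[t_0, …, t_j]/(t_i²) that kills the linear form but
not all of degree j + 1 (`not_surjective_of_pairs`).

Maximal rank. On a path one controls all powers of the sum of the variables, by induction removing
the last two vertices (`pathIndep_injective`, `initialSpan_pow_le`). Powers are needed because
isolating the multiples of an end vertex shifts the exponent by one. For m ≤ 2 the lollipop is a
path. For m ≥ 3 an independent set meets the clique at most once, and this reduces the claim to the
path (`cliquePathIndep_injective`, `initialSpan_pow_succ_le_of_clique`). -/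

open MvPolynomial

/-! ### Injectivity on paths, in terms of coefficients on independent sets. -/

/-- A finite set of natural numbers is independent in the infinite path. -/
def PathIndep (S : Finset ℕ) : Prop := ∀ i ∈ S, i + 1 ∉ S

theorem PathIndep.mono {S T : Finset ℕ} (hT : PathIndep T) (h : S ⊆ T) : PathIndep S :=
  fun i hi hi' => hT i (h hi) (h hi')

theorem pathIndep_insert {S : Finset ℕ} {a b : ℕ} (hS : PathIndep S)
    (hSb : S ⊆ Finset.range b) (hab : b < a ∨ (b = 0 ∧ a = 0)) : PathIndep (insert a S) := by
  intro i hi hi'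
  rw [Finset.mem_insert] at hi hi'
  have hlt : ∀ c ∈ S, c < b := fun c hc => Finset.mem_range.1 (hSb hc)
  rcases hi with rfl | hi <;> rcases hi' with h | h
  · omega
  · have := hlt _ h; omega
  · have := hlt _ hi; omega
  · exact hS i hi h

/-- Double counting of pairs of nested subsets, the larger one missing a single element. -/
theorem sum_powersetCard_sum_powersetCard {α M : Type*} [DecidableEq α] [AddCommMonoid M]
    (T : Finset α) (q r : ℕ) (hT : T.card = r + 1) (f : Finset α → M) :
    ∑ T' ∈ T.powersetCard r, ∑ S ∈ T'.powersetCard q, f S =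
      (r + 1 - q) • ∑ S ∈ T.powersetCard q, f S := by
  rw [Finset.sum_comm' (t' := T.powersetCard q)
    (s' := fun S => (T.powersetCard r).filter (fun T' => S ⊆ T'))]
  · rw [Finset.smul_sum]
    refine Finset.sum_congr rfl fun S hS => ?_
    rw [Finset.sum_const]
    congr 1
    rw [Finset.mem_powersetCard] at hS
    have : (T.powersetCard r).filter (fun T' => S ⊆ T') = (T \ S).image (fun a => T.erase a) := by
      ext T'
      simp only [Finset.mem_filter, Finset.mem_powersetCard, Finset.mem_image, Finset.mem_sdiff]
      constructor
      · rintro ⟨⟨h1, h2⟩, h3⟩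
        have hc : (T \ T').card = 1 := by rw [Finset.card_sdiff_of_subset h1]; omega
        obtain ⟨a, ha⟩ := Finset.card_eq_one.1 hc
        have haT : a ∈ T \ T' := by rw [ha]; simp
        rw [Finset.mem_sdiff] at haT
        refine ⟨a, ⟨haT.1, fun h => haT.2 (h3 h)⟩, ?_⟩
        rw [← Finset.sdiff_singleton_eq_erase, ← ha, Finset.sdiff_sdiff_eq_self h1]
      · rintro ⟨a, ⟨h1, h2⟩, rfl⟩
        refine ⟨⟨Finset.erase_subset _ _, ?_⟩, ?_⟩
        · rw [Finset.card_erase_of_mem h1]; omega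
        · exact Finset.subset_erase.2 ⟨hS.1, h2⟩
    rw [this, Finset.card_image_of_injOn, Finset.card_sdiff_of_subset hS.1, hT, hS.2]
    intro a ha b hb hab
    simp only [Finset.coe_sdiff, Set.mem_sdiff, Finset.mem_coe] at ha hb
    by_contra hne
    have : b ∈ T.erase a := Finset.mem_erase.2 ⟨Ne.symm hne, hb.1⟩
    simp only at hab
    rw [hab] at this
    simp at this
  · intro T' S
    simp only [Finset.mem_powersetCard, Finset.mem_filter]
    constructor
    · rintro ⟨⟨h1, h2⟩, h3, h4⟩
      exact ⟨⟨⟨h1, h2⟩, h3⟩, h3.trans h1, h4⟩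
    · rintro ⟨⟨⟨h1, h2⟩, h3⟩, h4, h5⟩
      exact ⟨⟨h1, h2⟩, h3, h5⟩

theorem sum_powersetCard_insert {α M : Type*} [DecidableEq α] [AddCommMonoid M]
    {T : Finset α} {a : α} (ha : a ∉ T) (j : ℕ) (f : Finset α → M) :
    ∑ S ∈ (insert a T).powersetCard (j + 1), f S =
      ∑ S ∈ T.powersetCard (j + 1), f S + ∑ S ∈ T.powersetCard j, f (insert a S) := by
  rw [Finset.powersetCard_succ_insert ha, Finset.sum_union, Finset.sum_image]
  · intro S hS S' hS' h
    have h1 := (Finset.mem_powersetCard.1 hS).1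
    have h2 := (Finset.mem_powersetCard.1 hS').1
    rw [← Finset.erase_insert (fun h => ha (h1 h)), h, Finset.erase_insert (fun h => ha (h2 h))]
  · rw [Finset.disjoint_left]
    intro S hS hS'
    obtain ⟨U, -, rfl⟩ := Finset.mem_image.1 hS'
    exact ha ((Finset.mem_powersetCard.1 hS).1 (Finset.mem_insert_self a U))

/-- In degree `j`, the `s`-th power of the sum of the variables is injective on the algebra of a
path with at least `4 j + 2 s - 1` vertices. An element of degree `j` is given by its
coefficients `f S`, and `∑ S ∈ T.powersetCard j, f S` is, up to the factor `s!`, the coefficient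
of its product with the power. -/
theorem pathIndep_injective {k : Type*} [Field k] [CharZero k] (n : ℕ) :
    ∀ (j s : ℕ) (f : Finset ℕ → k), 1 ≤ s → 4 * j + 2 * s ≤ n + 1 →
      (∀ T ⊆ Finset.range n, PathIndep T → T.card = j + s → ∑ S ∈ T.powersetCard j, f S = 0) →
      ∀ S ⊆ Finset.range n, PathIndep S → S.card = j → f S = 0 := by
  induction n using Nat.strong_induction_on with
  | _ n ih =>
  intro j s f hs hn hf S hSn hS hSj
  obtain _ | j := j
  · rw [Finset.card_eq_zero] at hSj
    subst hSj
    -- The independent set {0, 2, …, 2s - 2} fits because 2s - 1 ≤ n.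
    have := hf ((Finset.range s).image (fun i => 2 * i)) ?_ ?_ ?_
    · simpa using this
    · intro i hi
      simp only [Finset.mem_image, Finset.mem_range] at hi ⊢
      omega
    · intro i hi hi'
      simp only [Finset.mem_image, Finset.mem_range] at hi hi'
      omega
    · rw [Finset.card_image_of_injective _ (fun a b h => by simpa using h)]
      simp
  obtain ⟨l, rfl⟩ : ∃ l, n = l + 2 := ⟨n - 2, by omega⟩
  have hmem : ∀ {T : Finset ℕ} {b a : ℕ}, T ⊆ Finset.range b → b ≤ a → a ∉ T := by
    intro T b a hT hab ha
    have := Finset.mem_range.1 (hT ha)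
    omega
  have hsub : ∀ {T : Finset ℕ} {b a c : ℕ}, T ⊆ Finset.range b → b ≤ c → a < c →
      insert a T ⊆ Finset.range c := by
    intro T b a c hT hbc hac
    exact Finset.insert_subset (Finset.mem_range.2 hac)
      (hT.trans (Finset.range_mono hbc))
  have h1 : ∀ T ⊆ Finset.range l, PathIndep T → T.card = j + s →
      ∑ S ∈ T.powersetCard (j + 1), f S + ∑ S ∈ T.powersetCard j, f (insert (l + 1) S) = 0 := by
    intro T hTl hT hTc
    have hl : l + 1 ∉ T := hmem hTl (by omega)
    rw [← sum_powersetCard_insert hl]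
    refine hf _ (hsub hTl (by omega) (by omega)) (pathIndep_insert hT hTl (by omega)) ?_
    rw [Finset.card_insert_of_notMem hl]
    omega
  have h2 : ∀ T ⊆ Finset.range (l - 1), PathIndep T → T.card = j + s →
      ∑ S ∈ T.powersetCard (j + 1), f S + ∑ S ∈ T.powersetCard j, f (insert l S) = 0 := by
    intro T hTl hT hTc
    have hl : l ∉ T := hmem hTl (by omega)
    rw [← sum_powersetCard_insert hl]
    refine hf _ (hsub hTl (by omega) (by omega)) (pathIndep_insert hT hTl (by omega)) ?_
    rw [Finset.card_insert_of_notMem hl]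
    omega
  have h3 : ∀ T ⊆ Finset.range l, PathIndep T → T.card = j + 1 + s →
      ∑ S ∈ T.powersetCard (j + 1), f S = 0 := fun T hTl hT hTc =>
    hf T (hTl.trans (Finset.range_mono (by omega))) hT hTc
  -- Summing `h1` over the subsets of T with one element fewer turns its first term into a multiple
  -- of `h3`, which vanishes. What remains is s + 1 times the condition for the exponent s + 1; the
  -- numerical bound is preserved exactly.
  have ha : ∀ S ⊆ Finset.range l, PathIndep S → S.card = j → f (insert (l + 1) S) = 0 := by
    refine ih l (by omega) j (s + 1) (fun S => f (insert (l + 1) S)) (by omega) (by omega) ?_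
    intro T hTl hT hTc
    have hz : ∑ T' ∈ T.powersetCard (j + s), (∑ S ∈ T'.powersetCard (j + 1), f S +
        ∑ S ∈ T'.powersetCard j, f (insert (l + 1) S)) = 0 := by
      refine Finset.sum_eq_zero fun T' hT' => ?_
      rw [Finset.mem_powersetCard] at hT'
      exact h1 T' (hT'.1.trans hTl) (hT.mono hT'.1) hT'.2
    rw [Finset.sum_add_distrib, sum_powersetCard_sum_powersetCard T _ _ (by omega),
      sum_powersetCard_sum_powersetCard T _ _ (by omega), h3 T hTl hT (by omega), smul_zero,
      zero_add, nsmul_eq_mul, mul_eq_zero] at hz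
    refine hz.resolve_left ?_
    exact Nat.cast_ne_zero.2 (by omega)
  -- On sets avoiding l - 1 both l and l + 1 can be adjoined, and the difference of `h1` and `h2` no
  -- longer involves the coefficients in degree j + 1.
  have hb : ∀ S ⊆ Finset.range (l - 1), PathIndep S → S.card = j → f (insert l S) = 0 := by
    intro S hSl hS hSc
    have := ih (l - 1) (by omega) j s (fun S => f (insert l S) - f (insert (l + 1) S)) hs
      (by omega) ?_ S hSl hS hSc
    · rwa [ha S (hSl.trans (Finset.range_mono (by omega))) hS hSc, sub_zero] at this
    · intro T hTl hT hTc
      rw [Finset.sum_sub_distrib]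
      have e1 := h1 T (hTl.trans (Finset.range_mono (by omega))) hT hTc
      have e2 := h2 T hTl hT hTc
      linear_combination e2 - e1
  have hc : ∀ S ⊆ Finset.range l, PathIndep S → S.card = j + 1 → f S = 0 := by
    have key : ∀ T ⊆ Finset.range l, PathIndep T → T.card = j + s →
        ∑ S ∈ T.powersetCard (j + 1), f S = 0 := by
      intro T hTl hT hTc
      have := h1 T hTl hT hTc
      rwa [Finset.sum_eq_zero (s := T.powersetCard j), add_zero] at this
      intro S hS
      rw [Finset.mem_powersetCard] at hS
      exact ha S (hS.1.trans hTl) (hT.mono hS.1) hS.2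
    -- The exponent drops to s - 1. For s = 1 there is no power left to invert: T is its own only
    -- subset of size j + 1.
    obtain rfl | hs' := hs.eq_or_lt
    · intro S hSl hS hSc
      have := key S hSl hS hSc
      rwa [← hSc, Finset.powersetCard_self, Finset.sum_singleton] at this
    · refine ih l (by omega) (j + 1) (s - 1) f (by omega) (by omega) fun T hTl hT hTc => ?_
      exact key T hTl hT (by omega)
  by_cases hl1 : l + 1 ∈ S
  · rw [← Finset.insert_erase hl1]
    refine ha _ ?_ (hS.mono (Finset.erase_subset _ _)) (by
      rw [Finset.card_erase_of_mem hl1]; omega)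
    intro i hi
    rw [Finset.mem_erase] at hi
    have h := Finset.mem_range.1 (hSn hi.2)
    have : i ≠ l := by rintro rfl; exact hS i hi.2 hl1
    rw [Finset.mem_range]; omega
  by_cases hl : l ∈ S
  · rw [← Finset.insert_erase hl]
    refine hb _ ?_ (hS.mono (Finset.erase_subset _ _)) (by
      rw [Finset.card_erase_of_mem hl]; omega)
    intro i hi
    rw [Finset.mem_erase] at hi
    have h := Finset.mem_range.1 (hSn hi.2)
    have h3 : i ≠ l + 1 := by rintro rfl; exact hl1 hi.2
    have : i + 1 ≠ l := by rintro rfl; exact hS i hi.2 hl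
    rw [Finset.mem_range]; omega
  · refine hc S ?_ hS hSj
    intro i hi
    have h := Finset.mem_range.1 (hSn hi)
    have h3 : i ≠ l + 1 := by rintro rfl; exact hl1 hi
    have : i ≠ l := by rintro rfl; exact hl hi
    rw [Finset.mem_range]; omega

/-! ### Surjectivity on paths, in terms of powers of the span of the vertices. -/

theorem span_singleton_mul_sup_pow_le {k R : Type*} [CommSemiring k] [CommSemiring R] [Algebra k R]
    (P : Submodule k R) {x y : R} (h : y * x = 0) (d : ℕ) :
    Submodule.span k {y} * (P ⊔ Submodule.span k {x}) ^ d ≤ Submodule.span k {y} * P ^ d := by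
  induction d with
  | zero => simp
  | succ d ih =>
    rw [pow_succ', pow_succ', mul_left_comm, mul_left_comm (Submodule.span k {y}), Submodule.sup_mul]
    refine sup_le (mul_le_mul_right ih P) ?_
    have : Submodule.span k {x} * (Submodule.span k {y} * P ^ d) = ⊥ := by
      rw [← mul_assoc, Submodule.span_mul_span, Set.singleton_mul_singleton, mul_comm x, h]
      simp
    calc _ ≤ Submodule.span k {x} * (Submodule.span k {y} * P ^ d) := mul_le_mul_right ih _
      _ ≤ _ := by rw [this]; exact bot_le

/-- Since x² = 0, a nonzero product of generators contains the factor x at most once. -/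
theorem sup_span_singleton_pow_succ_le {k R : Type*} [CommSemiring k] [CommSemiring R] [Algebra k R]
    (P : Submodule k R) {x : R} (h : x * x = 0) (d : ℕ) :
    (P ⊔ Submodule.span k {x}) ^ (d + 1) ≤ P ^ (d + 1) ⊔ Submodule.span k {x} * P ^ d := by
  induction d with
  | zero => simp
  | succ d ih =>
    rw [pow_succ' _ (d + 1), Submodule.sup_mul]
    refine sup_le ?_ ?_
    · refine (mul_le_mul_right ih P).trans ?_
      rw [Submodule.mul_sup, ← pow_succ', mul_left_comm, ← pow_succ']
    · exact (span_singleton_mul_sup_pow_le P h (d + 1)).trans le_sup_right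

/-- The span of the first `n` terms of a sequence. -/
def initialSpan (k : Type*) {R : Type*} [CommSemiring k] [CommSemiring R] [Algebra k R]
    (x : ℕ → R) (n : ℕ) : Submodule k R :=
  Submodule.span k (x '' Set.Iio n)

section

variable {k R : Type*} [CommSemiring k] [CommSemiring R] [Algebra k R] (x : ℕ → R)

theorem initialSpan_zero : initialSpan k x 0 = ⊥ := by
  simp [initialSpan]

theorem initialSpan_succ (n : ℕ) :
    initialSpan k x (n + 1) = initialSpan k x n ⊔ Submodule.span k {x n} := by
  rw [initialSpan, initialSpan, ← Submodule.span_union]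
  congr 1
  ext y
  simp only [Set.mem_image, Set.mem_Iio, Set.union_singleton, Set.mem_insert_iff]
  constructor
  · rintro ⟨i, hi, rfl⟩
    rcases Nat.lt_succ_iff_lt_or_eq.1 hi with h | rfl
    · exact Or.inr ⟨i, h, rfl⟩
    · exact Or.inl rfl
  · rintro (rfl | ⟨i, hi, rfl⟩)
    · exact ⟨n, by omega, rfl⟩
    · exact ⟨i, by omega, rfl⟩

theorem sum_range_mem_initialSpan (n : ℕ) : ∑ i ∈ Finset.range n, x i ∈ initialSpan k x n :=
  sum_mem fun i hi => Submodule.subset_span ⟨i, Finset.mem_range.1 hi, rfl⟩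

/-- A power of the span of an initial segment of a path whose last vertex is not a neighbour of
`y` multiplied by `y`. -/
theorem mul_initialSpan_pow_le {y : R} {n : ℕ} (h : y * x n = 0) (d : ℕ) :
    Submodule.span k {y} * initialSpan k x (n + 1) ^ d ≤
      Submodule.span k {y} * initialSpan k x n ^ d := by
  rw [initialSpan_succ]
  exact span_singleton_mul_sup_pow_le _ h d

theorem span_singleton_mul_le_iff {y : R} {P N : Submodule k R} :
    Submodule.span k {y} * P ≤ N ↔ P ≤ N.comap (LinearMap.mulLeft k y) := by
  constructor
  · intro h g hg
    exact h (Submodule.mul_mem_mul (Submodule.mem_span_singleton_self y) hg)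
  · intro h
    rw [Submodule.span_singleton_mul]
    rintro _ ⟨g, hg, rfl⟩
    exact h hg

end

/-- The powers of the span of the vertices of a path: every submodule which contains the
multiples of the `s`-th power of the sum of the vertices contains all elements of degree `d`, if
the path has at most `3 d - s - 1` vertices. -/
theorem initialSpan_pow_le {k R : Type*} [Field k] [CharZero k] [CommRing R] [Algebra k R]
    (x : ℕ → R) (hx : ∀ i, x i * x i = 0) (hx' : ∀ i, x (i + 1) * x i = 0) (n : ℕ) :
    ∀ (d s : ℕ) (N : Submodule k R), 1 ≤ s → n + s + 1 ≤ 3 * d →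
      (∀ e, e + s = d → ∀ g ∈ initialSpan k x n ^ e, (∑ i ∈ Finset.range n, x i) ^ s * g ∈ N) →
      initialSpan k x n ^ d ≤ N := by
  induction n using Nat.strong_induction_on with
  | _ n ih =>
  -- For s > d the hypothesis `hN` is vacuous, and the claim is that the degree d part vanishes.
  intro d s N hs hn hN
  obtain ⟨d, rfl⟩ : ∃ d', d = d' + 1 := ⟨d - 1, by omega⟩
  obtain _ | _ | l := n
  · rw [initialSpan_zero, pow_succ]
    simp
  · obtain _ | d := d
    · obtain rfl : s = 1 := by omega
      rw [pow_one, initialSpan_succ, initialSpan_zero, bot_sup_eq, Submodule.span_singleton_le_iff_mem]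
      simpa using hN 0 rfl 1 (by rw [pow_zero]; exact Submodule.one_le.1 le_rfl)
    · rw [initialSpan_succ, initialSpan_zero]
      refine (sup_span_singleton_pow_succ_le _ (hx 0) _).trans ?_
      rw [pow_succ (⊥ : Submodule k R), pow_succ (⊥ : Submodule k R)]
      simp
  set L := ∑ i ∈ Finset.range l, x i with hL
  have hsum : ∑ i ∈ Finset.range (l + 1 + 1), x i = L + (x l + x (l + 1)) := by
    rw [Finset.sum_range_succ, Finset.sum_range_succ, add_assoc]
  -- The last two vertices are adjacent, so their sum has square zero and the binomial expansion
  -- stops after two terms.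
  have hsq : (x l + x (l + 1)) * (x l + x (l + 1)) = 0 := by
    linear_combination hx l + hx (l + 1) + 2 * hx' l
  have hpow : ∀ r : ℕ, (L + (x l + x (l + 1))) ^ (r + 1) =
      L ^ (r + 1) + (r + 1) * ((x l + x (l + 1)) * L ^ r) := by
    intro r
    induction r with
    | zero => simp
    | succ r ihr =>
      rw [pow_succ, ihr]
      push_cast
      linear_combination ((r : R) + 1) * L ^ r * hsq
  obtain ⟨r, rfl⟩ : ∃ r, s = r + 1 := ⟨s - 1, by omega⟩
  simp only [hsum] at hN
  have hmono : ∀ {i : ℕ}, i ≤ l + 2 → initialSpan k x i ≤ initialSpan k x (l + 1 + 1) := fun h =>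
    Submodule.span_mono (Set.image_mono (Set.Iio_subset_Iio h))
  have hmem : ∀ {i : ℕ}, i < l + 2 → x i ∈ initialSpan k x (l + 1 + 1) := fun h =>
    Submodule.subset_span ⟨_, h, rfl⟩
  have hpm : ∀ {i e : ℕ} {g : R}, i ≤ l + 2 → g ∈ initialSpan k x i ^ e →
      g ∈ initialSpan k x (l + 1 + 1) ^ e := fun h hg => pow_le_pow_left' (hmono h) _ hg
  -- the vertex before the last one
  have hB : Submodule.span k {x l} * initialSpan k x l ^ d ≤ N := by
    obtain hl0 | hl0 := Nat.eq_zero_or_pos l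
    · obtain ⟨c, rfl⟩ : ∃ c, d = c + 1 := ⟨d - 1, by omega⟩
      rw [hl0, initialSpan_zero, pow_succ]
      simp
    have hB' : initialSpan k x (l - 1) ^ d ≤ N.comap (LinearMap.mulLeft k (x l)) := by
      refine ih (l - 1) (by omega) d (r + 1) _ (by omega) (by omega) ?_
      intro e he g hg
      -- Multiplication by x_l kills x_{l-1}, x_l and x_{l+1}, so on multiples of x_l the full sum
      -- acts as the sum of the first l - 1 vertices.
      have hl : ∀ u : ℕ, x l * (∑ i ∈ Finset.range (l - 1), x i) ^ u =
          x l * (L + (x l + x (l + 1))) ^ u := by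
        have h1 : x l * (∑ i ∈ Finset.range (l - 1), x i) = x l * (L + (x l + x (l + 1))) := by
          obtain ⟨c, rfl⟩ : ∃ c, l = c + 1 := ⟨l - 1, by omega⟩
          rw [Nat.add_sub_cancel, hL, Finset.sum_range_succ]
          linear_combination - hx' c - hx (c + 1) - hx' (c + 1)
        intro u
        induction u with
        | zero => simp
        | succ u ihu => rw [pow_succ, pow_succ, ← mul_assoc, ihu, mul_right_comm, h1]; ring
      rw [Submodule.mem_comap, LinearMap.mulLeft_apply, ← mul_assoc, hl, mul_comm (x l), mul_assoc]
      refine hN (e + 1) (by omega) _ ?_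
      rw [pow_succ']
      exact Submodule.mul_mem_mul (hmem (by omega)) (hpm (by omega) hg)
    obtain ⟨c, rfl⟩ : ∃ c, l = c + 1 := ⟨l - 1, by omega⟩
    exact (mul_initialSpan_pow_le x (hx' c) d).trans (span_singleton_mul_le_iff.2 hB')
  have hB' : ∀ g ∈ initialSpan k x l ^ d, x l * g ∈ N := fun g hg =>
    hB (Submodule.mul_mem_mul (Submodule.mem_span_singleton_self _) hg)
  have hLmem : ∀ (u e : ℕ), ∀ g ∈ initialSpan k x l ^ e, L ^ u * g ∈ initialSpan k x l ^ (u + e) := by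
    intro u e g hg
    rw [pow_add]
    exact Submodule.mul_mem_mul (Submodule.pow_mem_pow _ (sum_range_mem_initialSpan x l) u) hg
  -- the rest of the path
  have hC : initialSpan k x l ^ (d + 1) ≤ N := by
    refine ih l (by omega) (d + 1) (r + 1 + 1) N (by omega) (by omega) ?_
    intro e he g hg
    have h1 := hN (e + 1) (by omega) (L * g) (by
      rw [pow_succ']
      exact Submodule.mul_mem_mul (hmono (by omega) (sum_range_mem_initialSpan x l))
        (hpm (by omega) hg))
    have h2 := hN (e + 1) (by omega) (x (l + 1) * g) (by
      rw [pow_succ']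
      exact Submodule.mul_mem_mul (hmem (by omega)) (hpm (by omega) hg))
    have h3 : x l * (L ^ (r + 1) * g) ∈ N := hB' _ (by
      have := hLmem (r + 1) e g hg
      rwa [show r + 1 + e = d by omega] at this)
    -- By `hpow` the first product exceeds the left side by (r + 1)(x_l + x_{l+1}) L^(r+1) g. The
    -- x_{l+1} part of this is again a multiple of the full power, since x_{l+1} kills x_l +
    -- x_{l+1}; the x_l part is covered by `hB'`.
    have h4 : L ^ (r + 1 + 1) * g = (L + (x l + x (l + 1))) ^ (r + 1) * (L * g)
        - ((r + 1 : ℕ) : k) • ((L + (x l + x (l + 1))) ^ (r + 1) * (x (l + 1) * g))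
        - ((r + 1 : ℕ) : k) • (x l * (L ^ (r + 1) * g)) := by
      rw [hpow, Nat.cast_smul_eq_nsmul, Nat.cast_smul_eq_nsmul, nsmul_eq_mul, nsmul_eq_mul]
      push_cast
      linear_combination (((r : R) + 1) * (r + 1) * L ^ r * g) * (hx (l + 1) + hx' l)
    rw [h4]
    exact N.sub_mem (N.sub_mem h1 (N.smul_mem _ h2)) (N.smul_mem _ h3)
  -- the last vertex
  have hA : initialSpan k x l ^ d ≤ N.comap (LinearMap.mulLeft k (x (l + 1))) := by
    -- The other terms of the expansion of the full power lie in N by `hC` and `hB'`; dividing by r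
    -- + 1 uses characteristic zero. On multiples of x_{l+1} the exponent has dropped from r + 1 to
    -- r.
    have key : ∀ e, e + r = d → ∀ g ∈ initialSpan k x l ^ e, x (l + 1) * (L ^ r * g) ∈ N := by
      intro e he g hg
      have h1 := hN e (by omega) g (hpm (by omega) hg)
      have h2 : L ^ (r + 1) * g ∈ N := hC (by
        have := hLmem (r + 1) e g hg
        rwa [show r + 1 + e = d + 1 by omega] at this)
      have h3 : x l * (L ^ r * g) ∈ N := hB' _ (by
        have := hLmem r e g hg
        rwa [show r + e = d by omega] at this)
      have hr : ((r + 1 : ℕ) : k) ≠ 0 := Nat.cast_ne_zero.2 (by omega)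
      rw [← Submodule.smul_mem_iff N hr]
      have h4 : ((r + 1 : ℕ) : k) • (x (l + 1) * (L ^ r * g)) =
          (L + (x l + x (l + 1))) ^ (r + 1) * g - L ^ (r + 1) * g
          - ((r + 1 : ℕ) : k) • (x l * (L ^ r * g)) := by
        rw [hpow, Nat.cast_smul_eq_nsmul, Nat.cast_smul_eq_nsmul, nsmul_eq_mul, nsmul_eq_mul]
        push_cast
        ring
      rw [h4]
      exact N.sub_mem (N.sub_mem h1 h2) (N.smul_mem _ h3)
    obtain _ | r := r
    · intro g hg
      simpa using key d rfl g hg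
    · refine ih l (by omega) d (r + 1) _ (by omega) (by omega) ?_
      intro e he g hg
      exact key e (by omega) g hg
  rw [initialSpan_succ]
  refine (sup_span_singleton_pow_succ_le _ (hx _) _).trans (sup_le ?_ ?_)
  · rw [initialSpan_succ]
    exact (sup_span_singleton_pow_succ_le _ (hx _) _).trans (sup_le hC hB)
  · exact (mul_initialSpan_pow_le x (hx' l) d).trans (span_singleton_mul_le_iff.2 hA)

/-! ### The monomial basis of the algebra of a graph. -/

/-- The exponent vector of the squarefree monomial with support `S`. -/
noncomputable def squarefreeExponent {V : Type*} (S : Finset V) : V →₀ ℕ :=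
  ∑ v ∈ S, Finsupp.single v 1

section

variable {V : Type*}

theorem squarefreeExponent_apply [DecidableEq V] (S : Finset V) (v : V) :
    squarefreeExponent S v = if v ∈ S then 1 else 0 := by
  simp [squarefreeExponent, Finsupp.finsetSum_apply, Finsupp.single_apply]

theorem squarefreeExponent_support (S : Finset V) : (squarefreeExponent S).support = S := by
  classical
  ext v
  simp [squarefreeExponent_apply]

theorem squarefreeExponent_injective :
    Function.Injective (squarefreeExponent : Finset V → V →₀ ℕ) := fun S T h => by
  rw [← squarefreeExponent_support S, h, squarefreeExponent_support]

theorem squarefreeExponent_degree (S : Finset V) : (squarefreeExponent S).degree = S.card := by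
  simp [squarefreeExponent, map_sum]

theorem squarefreeExponent_sub_single [DecidableEq V] {S : Finset V} {v : V} (hv : v ∈ S) :
    squarefreeExponent S - Finsupp.single v 1 = squarefreeExponent (S.erase v) := by
  rw [squarefreeExponent, ← Finset.add_sum_erase S _ hv, add_tsub_cancel_left, squarefreeExponent]

variable {k : Type*} [CommRing k]

theorem coeff_sum_mul_squarefreeExponent [Fintype V] [DecidableEq V] (a : V → k)
    (p : MvPolynomial V k) (T : Finset V) :
    coeff (squarefreeExponent T) ((∑ v, C (a v) * X v) * p) =
      ∑ v ∈ T, a v * coeff (squarefreeExponent (T.erase v)) p := by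
  rw [Finset.sum_mul, coeff_sum, ← Finset.sum_subset (Finset.subset_univ T)]
  · refine Finset.sum_congr rfl fun v hv => ?_
    rw [mul_assoc, coeff_C_mul, coeff_X_mul', squarefreeExponent_support, if_pos hv,
      squarefreeExponent_sub_single hv]
  · intro v _ hv
    rw [mul_assoc, coeff_C_mul, coeff_X_mul', squarefreeExponent_support, if_neg hv, mul_zero]

variable (G : SimpleGraph V)

theorem graphIdeal_eq_span_monomial : graphIdeal k G =
    Ideal.span ((fun s => monomial s (1 : k)) ''
      (Set.range (fun v : V => Finsupp.single v 2) ∪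
        {m | ∃ u v, G.Adj u v ∧ m = Finsupp.single u 1 + Finsupp.single v 1})) := by
  rw [graphIdeal, edgeIdeal, Submodule.add_eq_sup, ← Ideal.span_union, Set.image_union]
  congr 2
  · rw [← Set.range_comp]
    congr 1
    ext1 v
    simp [X_pow_eq_monomial]
  · ext p
    simp only [Set.mem_ofPred_eq, Set.mem_image]
    constructor
    · rintro ⟨u, v, h, rfl⟩
      exact ⟨_, ⟨u, v, h, rfl⟩, by simp [X, monomial_mul]⟩
    · rintro ⟨_, ⟨u, v, h, rfl⟩, rfl⟩
      exact ⟨u, v, h, by simp [X, monomial_mul]⟩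

/-- The ideal is monomial, and the monomials outside it are the squarefree ones with independent
support. This turns identities in the algebra into equations between coefficients. -/
theorem mem_graphIdeal_iff (p : MvPolynomial V k) : p ∈ graphIdeal k G ↔
    ∀ S : Finset V, G.IsIndepSet (S : Set V) → coeff (squarefreeExponent S) p = 0 := by
  classical
  rw [graphIdeal_eq_span_monomial, mem_ideal_span_monomial_image]
  constructor
  · intro h S hS
    by_contra hne
    obtain ⟨m, hm, hle⟩ := h _ (mem_support_iff.2 hne)
    rcases hm with ⟨v, rfl⟩ | ⟨u, v, huv, rfl⟩
    · have := hle v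
      simp only [Finsupp.single_eq_same, squarefreeExponent_apply] at this
      split_ifs at this <;> omega
    · have hu := hle u
      have hv := hle v
      simp only [Finsupp.add_apply, Finsupp.single_eq_same, squarefreeExponent_apply] at hu hv
      have hu' : u ∈ S := by by_contra h; simp [h] at hu
      have hv' : v ∈ S := by by_contra h; simp [h] at hv
      exact hS hu' hv' huv.ne huv
  · intro h m hm
    by_contra hne
    push Not at hne
    have h1 : ∀ v, m v ≤ 1 := by
      intro v
      by_contra hv
      refine hne _ (Or.inl ⟨v, rfl⟩) ?_
      rw [Finsupp.single_le_iff]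
      omega
    have h2 : m = squarefreeExponent m.support := by
      ext v
      rw [squarefreeExponent_apply]
      have := h1 v
      split_ifs with h0
      · have := Finsupp.mem_support_iff.1 h0
        omega
      · exact Finsupp.notMem_support_iff.1 h0
    refine mem_support_iff.1 hm ?_
    rw [h2]
    refine h _ ?_
    intro u hu v hv huv hadj
    refine hne _ (Or.inr ⟨u, v, hadj, rfl⟩) ?_
    intro w
    have hu' := Finsupp.mem_support_iff.1 hu
    have hv' := Finsupp.mem_support_iff.1 hv
    simp only [Finsupp.add_apply, Finsupp.single_apply]
    split_ifs with e1 e2 e2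
    · exact absurd (e1.trans e2.symm) huv
    · subst e1; omega
    · subst e2; omega
    · omega

namespace GraphAlgebra

variable (k)

/-- The class of a variable in the algebra of a graph. -/
noncomputable def var (v : V) : GraphAlgebra k G := Ideal.Quotient.mkₐ k (graphIdeal k G) (X v)

variable {G}

theorem var_mul_self (v : V) : var k G v * var k G v = 0 := by
  rw [var, ← map_mul, ← pow_two]
  exact Ideal.Quotient.eq_zero_iff_mem.2 (Ideal.mem_sup_left (Ideal.subset_span ⟨v, rfl⟩))

theorem var_mul_var {u v : V} (h : G.Adj u v) : var k G u * var k G v = 0 := by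
  rw [var, var, ← map_mul]
  exact Ideal.Quotient.eq_zero_iff_mem.2 (Ideal.mem_sup_right (Ideal.subset_span ⟨u, v, h, rfl⟩))

theorem grading_one : grading k G 1 = Submodule.span k (Set.range (var k G)) := by
  rw [grading, quotientGrading, homogeneousSubmodule_one_eq_span_X, Submodule.map_span,
    ← Set.range_comp]
  rfl

theorem grading_eq_pow (j : ℕ) : grading k G j = grading k G 1 ^ j := by
  rw [grading, quotientGrading, quotientGrading, ← homogeneousSubmodule_one_pow, Submodule.map_pow]

theorem var_mem (v : V) : var k G v ∈ grading k G 1 := by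
  rw [grading_one]
  exact Submodule.subset_span ⟨v, rfl⟩

theorem exists_eq_sum_of_mem_grading_one [Fintype V] {g : GraphAlgebra k G}
    (hg : g ∈ grading k G 1) : ∃ a : V → k, g = ∑ v, a v • var k G v := by
  rw [grading_one, Submodule.mem_span_range_iff_exists_fun] at hg
  obtain ⟨a, rfl⟩ := hg
  exact ⟨a, rfl⟩

theorem sum_smul_var [Fintype V] (a : V → k) : ∑ v, a v • var k G v =
    Ideal.Quotient.mkₐ k (graphIdeal k G) (∑ v, C (a v) * X v) := by
  simp only [map_sum, var, ← map_smul, smul_eq_C_mul]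

variable {k}

/-- Algebra homomorphisms out of the algebra of a graph. -/
noncomputable def lift {B : Type*} [CommRing B] [Algebra k B] (w : V → B)
    (h : ∀ v, w v * w v = 0) (h' : ∀ u v, G.Adj u v → w u * w v = 0) : GraphAlgebra k G →ₐ[k] B :=
  Ideal.Quotient.liftₐ (graphIdeal k G) (aeval w) fun p hp => by
    have : graphIdeal k G ≤ RingHom.ker (aeval (R := k) w) := by
      refine sup_le (Ideal.span_le.2 ?_) (Ideal.span_le.2 ?_)
      · rintro _ ⟨v, rfl⟩
        simp [RingHom.mem_ker, pow_two, h]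
      · rintro _ ⟨u, v, huv, rfl⟩
        simp [RingHom.mem_ker, h' u v huv]
    exact RingHom.mem_ker.1 (this hp)

theorem lift_var {B : Type*} [CommRing B] [Algebra k B] (w : V → B)
    (h : ∀ v, w v * w v = 0) (h' : ∀ u v, G.Adj u v → w u * w v = 0) (v : V) :
    lift (k := k) w h h' (var k G v) = w v := by
  change aeval w (X v) = w v
  exact aeval_X w v

/-- The algebra of the edgeless graph is k[t_1, …, t_d]/(t_i²), the target of the specializations in
both obstructions; its top monomial detects nonvanishing. -/
theorem prod_var_bot_ne_zero [Nontrivial k] (d : ℕ) :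
    ∏ i, var k (⊥ : SimpleGraph (Fin d)) i ≠ 0 := by
  have h : ∏ i, var k (⊥ : SimpleGraph (Fin d)) i =
      Ideal.Quotient.mkₐ k _ (monomial (squarefreeExponent Finset.univ) 1) := by
    simp only [var, ← map_prod]
    congr 1
    rw [squarefreeExponent, monomial_sum_one]
    rfl
  rw [h]
  intro h0
  have := (mem_graphIdeal_iff _ _).1 (Ideal.Quotient.eq_zero_iff_mem.1 h0) Finset.univ
    (by intro u _ v _ _; simp)
  simp at this

end GraphAlgebra

end

/-! ### Obstructions to injectivity and surjectivity for arbitrary linear forms. -/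

/-- A nonzero finite family of polynomials, divided by a power of the variable, specializes to
a nonzero family at zero. -/
theorem exists_eq_X_pow_mul_eval_zero_ne_zero {k ι : Type*} [Field k] (P : ι → Polynomial k)
    (h : ∃ i, P i ≠ 0) :
    ∃ (r : ℕ) (Q : ι → Polynomial k), (∀ i, P i = Polynomial.X ^ r * Q i) ∧
      ∃ i, (Q i).eval 0 ≠ 0 := by
  obtain ⟨i, hi⟩ := h
  induction hd : (P i).natDegree generalizing P with
  | zero =>
    refine ⟨0, P, by simp, i, ?_⟩
    rw [Polynomial.eq_C_of_natDegree_eq_zero hd] at hi ⊢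
    simpa using hi
  | succ d ih =>
    by_cases h0 : ∃ i, (P i).eval 0 ≠ 0
    · exact ⟨0, P, by simp, h0⟩
    push Not at h0
    have hP : ∀ i, P i = Polynomial.X * (P i).divX := by
      intro i
      conv_lhs => rw [← Polynomial.X_mul_divX_add (P i), Polynomial.coeff_zero_eq_eval_zero, h0 i]
      simp
    obtain ⟨r, Q, hQ, hQ'⟩ := ih (fun i => (P i).divX) (fun h => hi (by rw [hP i, h, mul_zero]))
      (by rw [Polynomial.natDegree_divX_eq_natDegree_tsub_one, hd]; rfl)
    exact ⟨r + 1, Q, fun i => by rw [hP i, hQ i]; ring, hQ'⟩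

theorem prod_mem_pow_card {k R ι : Type*} [CommSemiring k] [CommSemiring R] [Algebra k R]
    {P : Submodule k R} {f : ι → R} (hf : ∀ i, f i ∈ P) (s : Finset ι) :
    ∏ i ∈ s, f i ∈ P ^ s.card := by
  classical
  induction s using Finset.induction_on with
  | empty =>
    rw [Finset.prod_empty, Finset.card_empty, pow_zero]
    exact Submodule.one_le.1 le_rfl
  | insert i s hi ih =>
    rw [Finset.prod_insert hi, Finset.card_insert_of_notMem hi, pow_succ']
    exact Submodule.mul_mem_mul (hf i) ih

namespace GraphAlgebra

variable {k V : Type*} [Field k] {G : SimpleGraph V} [Fintype V]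

/-- If the sum of the variables is a zero divisor in some degree, then so is every linear form. -/
theorem not_injective_of_sum_var_mul_eq_zero {j : ℕ} {g : GraphAlgebra k G}
    (hg : g ∈ grading k G j) (hg0 : g ≠ 0) (h : (∑ v, var k G v) * g = 0) (ℓ : grading k G 1) :
    ¬ Function.Injective (gradedMulMap (grading k G) ℓ j) := by
  classical
  intro hinj
  obtain ⟨p, hp, rfl⟩ := hg
  obtain ⟨a, ha⟩ := exists_eq_sum_of_mem_grading_one k ℓ.2
  have hp' : ¬ p ∈ graphIdeal k G := fun h => hg0 (Ideal.Quotient.eq_zero_iff_mem.2 h)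
  rw [mem_graphIdeal_iff] at hp'
  push Not at hp'
  obtain ⟨S₀, hS₀, hne⟩ := hp'
  have hdeg : ∀ S : Finset V, coeff (squarefreeExponent S) p ≠ 0 → S.card = j := by
    intro S hS
    rw [← squarefreeExponent_degree S, Finsupp.degree_eq_weight_one]
    exact hp hS
  have hker : ∀ T : Finset V, G.IsIndepSet (T : Set V) →
      ∑ v ∈ T, coeff (squarefreeExponent (T.erase v)) p = 0 := by
    have h1 : (∑ v, C (1 : k) * X v) * p ∈ graphIdeal k G := by
      refine Ideal.Quotient.eq_zero_iff_mem.1 ?_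
      have := sum_smul_var k (G := G) (fun _ => (1 : k))
      simp only [one_smul] at this
      rw [this, AlgHom.toLinearMap_apply, ← map_mul] at h
      exact h
    intro T hT
    have := (mem_graphIdeal_iff G _).1 h1 T hT
    rw [coeff_sum_mul_squarefreeExponent (fun _ => (1 : k))] at this
    simpa using this
  -- the coefficients of a perturbed kernel element
  set P : Finset V → Polynomial k := fun S =>
    if G.IsIndepSet (S : Set V) then Polynomial.C (coeff (squarefreeExponent S) p) *
      ∏ v ∈ S, (Polynomial.C (a v) + Polynomial.X) else 0 with hP
  -- If some a_v vanish, setting X = 0 in `P` could give zero. Removing the common power of X first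
  -- leaves a nonzero limit, still in the kernel of the form with coefficients a_v.
  obtain ⟨r, Q, hQ, S₁, hS₁⟩ := exists_eq_X_pow_mul_eval_zero_ne_zero P ⟨S₀, by
    simp only [hP, if_pos hS₀]
    refine mul_ne_zero (Polynomial.C_ne_zero.2 hne) (Finset.prod_ne_zero_iff.2 fun v _ => ?_)
    rw [add_comm]
    exact Polynomial.X_add_C_ne_zero _⟩
  have hQ0 : ∀ S, P S = 0 → Q S = 0 := by
    intro S hS
    rw [hQ S] at hS
    exact (mul_eq_zero.1 hS).resolve_left (pow_ne_zero _ Polynomial.X_ne_zero)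
  have hQi : ∀ S, Q S ≠ 0 → G.IsIndepSet (S : Set V) ∧ S.card = j := by
    intro S hS
    have h1 : P S ≠ 0 := fun h => hS (hQ0 S h)
    simp only [hP] at h1
    split_ifs at h1 with h2
    · exact ⟨h2, hdeg S fun h => h1 (by rw [h]; simp)⟩
    · exact absurd rfl h1
  have hQk : ∀ T : Finset V, G.IsIndepSet (T : Set V) →
      ∑ v ∈ T, a v * (Q (T.erase v)).eval 0 = 0 := by
    intro T hT
    -- All summands share the factor ∏ (a_v + X) over T; the cofactor is the kernel equation `hker`.
    have h1 : ∑ v ∈ T, (Polynomial.C (a v) + Polynomial.X) * P (T.erase v) = 0 := by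
      have : ∀ v ∈ T, (Polynomial.C (a v) + Polynomial.X) * P (T.erase v) =
          Polynomial.C (coeff (squarefreeExponent (T.erase v)) p) *
            ∏ v ∈ T, (Polynomial.C (a v) + Polynomial.X) := by
        intro v hv
        simp only [hP]
        rw [if_pos, ← Finset.mul_prod_erase T _ hv]
        · ring
        · exact hT.mono (by exact_mod_cast Finset.erase_subset v T)
      rw [Finset.sum_congr rfl this, ← Finset.sum_mul, ← map_sum, hker T hT]
      simp
    have h2 : Polynomial.X ^ r *
        ∑ v ∈ T, (Polynomial.C (a v) + Polynomial.X) * Q (T.erase v) = 0 := by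
      rw [← h1, Finset.mul_sum]
      refine Finset.sum_congr rfl fun v _ => ?_
      rw [hQ]
      ring
    have h3 := congrArg (Polynomial.eval 0)
      ((mul_eq_zero.1 h2).resolve_left (pow_ne_zero _ Polynomial.X_ne_zero))
    simpa [Polynomial.eval_finsetSum] using h3
  set p' : MvPolynomial V k := ∑ S, C ((Q S).eval 0) * monomial (squarefreeExponent S) 1 with hp'
  have hcoeff : ∀ S, coeff (squarefreeExponent S) p' = (Q S).eval 0 := by
    intro S
    simp [hp', coeff_sum, coeff_C_mul, coeff_monomial, squarefreeExponent_injective.eq_iff]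
  have hhom : p' ∈ homogeneousSubmodule V k j := by
    refine sum_mem fun S _ => ?_
    by_cases hS : Q S = 0
    · simp [hS]
    · rw [← smul_eq_C_mul]
      refine Submodule.smul_mem _ _ (isHomogeneous_monomial _ ?_)
      rw [squarefreeExponent_degree]
      exact (hQi S hS).2
  have hzero : gradedMulMap (grading k G) ℓ j
      ⟨Ideal.Quotient.mkₐ k (graphIdeal k G) p', p', hhom, rfl⟩ = 0 := by
    refine Subtype.ext ?_
    change (ℓ : GraphAlgebra k G) * Ideal.Quotient.mkₐ k (graphIdeal k G) p' = 0
    rw [ha, sum_smul_var, ← map_mul]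
    refine Ideal.Quotient.eq_zero_iff_mem.2 ((mem_graphIdeal_iff G _).2 fun T hT => ?_)
    rw [coeff_sum_mul_squarefreeExponent]
    simpa only [hcoeff] using hQk T hT
  have hz := hinj (hzero.trans (map_zero _).symm)
  have hz' : p' ∈ graphIdeal k G := Ideal.Quotient.eq_zero_iff_mem.1 (congrArg Subtype.val hz)
  refine hS₁ ?_
  rw [← hcoeff]
  exact (mem_graphIdeal_iff G _).1 hz' S₁ (hQi S₁ fun h => hS₁ (by rw [h]; simp)).1

/-- A partition of a graph into `2 j` cliques, grouped in pairs, such that the first cliques of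
the pairs have an independent set of representatives, gives an element of degree `j` which is
annihilated by the sum of the variables. -/
theorem not_injective_of_clique_cover {j : ℕ} (q : V → Fin j × Bool)
    (hq : ∀ u v, u ≠ v → q u = q v → G.Adj u v) (rep : Fin j → V)
    (hrep : ∀ i, q (rep i) = (i, false)) (hind : ∀ i i', ¬ G.Adj (rep i) (rep i'))
    (ℓ : grading k G 1) : ¬ Function.Injective (gradedMulMap (grading k G) ℓ j) := by
  classical
  set s : Fin j × Bool → GraphAlgebra k G := fun c => ∑ v with q v = c, var k G v with hs
  have hss : ∀ c, s c * s c = 0 := by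
    intro c
    simp only [hs, Finset.sum_mul_sum]
    refine Finset.sum_eq_zero fun u hu => Finset.sum_eq_zero fun v hv => ?_
    rw [Finset.mem_filter] at hu hv
    by_cases huv : u = v
    · rw [huv, var_mul_self]
    · exact var_mul_var k (hq u v huv (hu.2.trans hv.2.symm))
  have hsmem : ∀ c, s c ∈ grading k G 1 := fun c => sum_mem fun v _ => var_mem k v
  refine not_injective_of_sum_var_mul_eq_zero (g := ∏ i, (s (i, false) - s (i, true))) ?_ ?_ ?_ ℓ
  · rw [grading_eq_pow]
    simpa using prod_mem_pow_card
      (fun i => (grading k G 1).sub_mem (hsmem (i, false)) (hsmem (i, true))) Finset.univ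
  · have hinjr : Function.Injective rep := fun i i' h => by
      have := hrep i
      rw [h, hrep i'] at this
      exact (congrArg Prod.fst this).symm
    -- Killing all vertices except the representatives sends s (i, false) to t_i and s (i, true) to
    -- 0, so the product maps to the top monomial.
    set w : V → GraphAlgebra k (⊥ : SimpleGraph (Fin j)) :=
      Function.extend rep (fun i => var k ⊥ i) 0 with hw
    have hw1 : ∀ i, w (rep i) = var k ⊥ i := fun i => hinjr.extend_apply _ _ _
    have hw0 : ∀ v, (∀ i, v ≠ rep i) → w v = 0 := fun v hv =>
      Function.extend_apply' _ _ _ fun ⟨i, hi⟩ => hv i hi.symm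
    have hwsq : ∀ v, w v * w v = 0 := by
      intro v
      by_cases hv : ∃ i, v = rep i
      · obtain ⟨i, rfl⟩ := hv
        rw [hw1, var_mul_self]
      · push Not at hv
        rw [hw0 v hv, mul_zero]
    have hwadj : ∀ u v, G.Adj u v → w u * w v = 0 := by
      intro u v huv
      by_cases hu : ∃ i, u = rep i
      · obtain ⟨i, rfl⟩ := hu
        rw [hw0 v, mul_zero]
        rintro i' rfl
        exact hind _ _ huv
      · push Not at hu
        rw [hw0 u hu, zero_mul]
    intro h0
    refine prod_var_bot_ne_zero (k := k) j ?_
    have := congrArg (lift (k := k) w hwsq hwadj) h0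
    rw [map_zero, map_prod] at this
    rw [← this]
    refine Finset.prod_congr rfl fun i _ => ?_
    simp only [hs, map_sub, map_sum, lift_var]
    rw [Finset.sum_eq_single (rep i), Finset.sum_eq_zero, sub_zero, hw1]
    · intro v hv
      rw [Finset.mem_filter] at hv
      refine hw0 v ?_
      rintro i' rfl
      rw [hrep] at hv
      simp at hv
    · intro v hv hvi
      rw [Finset.mem_filter] at hv
      refine hw0 v ?_
      rintro i' rfl
      rw [hrep] at hv
      simp only [Prod.mk.injEq, and_true] at hv
      exact hvi (by rw [hv.2])
    · intro h
      exact absurd (Finset.mem_filter.2 ⟨Finset.mem_univ (rep i), hrep i⟩) h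
  · have hsum : ∑ v, var k G v = ∑ i, (s (i, false) + s (i, true)) := by
      rw [← Finset.sum_fiberwise Finset.univ q, Fintype.sum_prod_type]
      refine Finset.sum_congr rfl fun i _ => ?_
      rw [Fintype.sum_bool, add_comm]
    rw [hsum, Finset.sum_mul]
    refine Finset.sum_eq_zero fun i hi => ?_
    rw [← Finset.mul_prod_erase _ _ hi, ← mul_assoc]
    have : (s (i, false) + s (i, true)) * (s (i, false) - s (i, true)) = 0 := by
      linear_combination hss (i, false) - hss (i, true)
    rw [this, zero_mul]

/-- If a graph has `j + 1` pairs of vertices with no edges between distinct pairs, then no linear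
form is surjective from degree `j` to degree `j + 1`. -/
theorem not_surjective_of_pairs {j : ℕ} (D : Fin (j + 1) × Bool → V) (hD : Function.Injective D)
    (hind : ∀ c c', c.1 ≠ c'.1 → ¬ G.Adj (D c) (D c')) (ℓ : grading k G 1) :
    ¬ Function.Surjective (gradedMulMap (grading k G) ℓ j) := by
  classical
  intro hsurj
  obtain ⟨a, ha⟩ := exists_eq_sum_of_mem_grading_one k ℓ.2
  -- On each pair, a nonzero vector orthogonal to the coefficients of ℓ. Sending the two vertices to
  -- these multiples of t_i kills ℓ, while the vertex at an index b with u b ≠ 0 survives.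
  have hex : ∀ i, ∃ u : Bool → k, (a (D (i, false)) * u false + a (D (i, true)) * u true = 0) ∧
      ∃ b, u b ≠ 0 := by
    intro i
    by_cases h : a (D (i, true)) = 0
    · exact ⟨fun b => if b then 1 else 0, by simp [h], true, by simp⟩
    · exact ⟨fun b => if b then - a (D (i, false)) else a (D (i, true)), by simp; ring, false,
        by simpa using h⟩
  choose u hu b hb using hex
  set t : Fin (j + 1) → GraphAlgebra k (⊥ : SimpleGraph (Fin (j + 1))) := fun i => var k ⊥ i with ht
  set w : V → GraphAlgebra k (⊥ : SimpleGraph (Fin (j + 1))) :=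
    Function.extend D (fun c => u c.1 c.2 • t c.1) 0 with hw
  have hw1 : ∀ c, w (D c) = u c.1 c.2 • t c.1 := fun c => hD.extend_apply _ _ _
  have hw0 : ∀ v, (∀ c, v ≠ D c) → w v = 0 := fun v hv =>
    Function.extend_apply' _ _ _ fun ⟨c, hc⟩ => hv c hc.symm
  have hwadj' : ∀ c c', c.1 = c'.1 → w (D c) * w (D c') = 0 := by
    intro c c' h
    rw [hw1, hw1, h, smul_mul_smul_comm, var_mul_self, smul_zero]
  have hwsq : ∀ v, w v * w v = 0 := by
    intro v
    by_cases hv : ∃ c, v = D c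
    · obtain ⟨c, rfl⟩ := hv
      exact hwadj' c c rfl
    · push Not at hv
      rw [hw0 v hv, mul_zero]
  have hwadj : ∀ v v', G.Adj v v' → w v * w v' = 0 := by
    intro v v' h
    by_cases hv : ∃ c, v = D c
    · by_cases hv' : ∃ c, v' = D c
      · obtain ⟨c, rfl⟩ := hv
        obtain ⟨c', rfl⟩ := hv'
        by_cases hc : c.1 = c'.1
        · exact hwadj' c c' hc
        · exact absurd h (hind c c' hc)
      · push Not at hv'
        rw [hw0 v' hv', mul_zero]
    · push Not at hv
      rw [hw0 v hv, zero_mul]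
  have hℓ : lift (k := k) w hwsq hwadj ℓ = 0 := by
    rw [ha, map_sum]
    simp only [map_smul, lift_var]
    rw [← Finset.sum_subset (Finset.subset_univ (Finset.univ.image D)),
      Finset.sum_image hD.injOn, Fintype.sum_prod_type]
    · refine Finset.sum_eq_zero fun i _ => ?_
      rw [Fintype.sum_bool, hw1, hw1, smul_smul, smul_smul, ← add_smul]
      rw [show a (D (i, true)) * u i true + a (D (i, false)) * u i false = 0 by
        rw [add_comm, hu], zero_smul]
    · intro v _ hv
      rw [hw0 v, smul_zero]
      rintro c rfl
      exact hv (Finset.mem_image_of_mem _ (Finset.mem_univ c))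
  have hmem : ∏ i, var k G (D (i, b i)) ∈ grading k G (j + 1) := by
    rw [grading_eq_pow]
    simpa using prod_mem_pow_card (fun i => var_mem k (G := G) (D (i, b i))) Finset.univ
  obtain ⟨g, hg⟩ := hsurj ⟨_, hmem⟩
  have hg' : (ℓ : GraphAlgebra k G) * g = ∏ i, var k G (D (i, b i)) := congrArg Subtype.val hg
  have h1 := congrArg (lift (k := k) w hwsq hwadj) hg'
  rw [map_mul, hℓ, zero_mul, map_prod] at h1
  simp only [lift_var, hw1, Finset.prod_smul] at h1
  rcases smul_eq_zero.1 h1.symm with h2 | h2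
  · obtain ⟨i, -, hi⟩ := Finset.prod_eq_zero_iff.1 h2
    exact hb i hi
  · exact prod_var_bot_ne_zero (k := k) _ h2

end GraphAlgebra

/-! ### Maximal rank on a path prolonged by a clique. -/

/-- A finite set of natural numbers is independent in the infinite path whose vertices from `n`
on are made pairwise adjacent. -/
def CliquePathIndep (n : ℕ) (S : Finset ℕ) : Prop :=
  ∀ a ∈ S, ∀ b ∈ S, a < b → a + 1 ≠ b ∧ a < n

theorem CliquePathIndep.pathIndep {n : ℕ} {S : Finset ℕ} (h : CliquePathIndep n S) :
    PathIndep S := fun i hi hi' => (h i hi _ hi' (by omega)).1 rfl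

/-- Among the first n + 2 vertices only n and n + 1 belong to the clique, and these are already
adjacent in the path. -/
theorem PathIndep.cliquePathIndep {n N : ℕ} {S : Finset ℕ} (h : PathIndep S)
    (hS : S ⊆ Finset.range N) (hN : N ≤ n + 2) : CliquePathIndep n S := by
  intro a ha b hb hab
  have h1 := Finset.mem_range.1 (hS hb)
  have h2 : a + 1 ≠ b := by rintro rfl; exact h a ha hb
  omega

theorem PathIndep.cliquePathIndep_insert {n N p : ℕ} {S : Finset ℕ} (h : PathIndep S)
    (hS : S ⊆ Finset.range N) (hN : N ≤ n) (hp : N < p) : CliquePathIndep n (insert p S) := by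
  intro a ha b hb hab
  rw [Finset.mem_insert] at ha hb
  have h3 : ∀ c ∈ S, c < N := fun c hc => Finset.mem_range.1 (hS hc)
  rcases ha with rfl | ha <;> rcases hb with rfl | hb
  · omega
  · have := h3 b hb; omega
  · have := h3 a ha; omega
  · have := h3 a ha
    have h2 : a + 1 ≠ b := by rintro rfl; exact h a ha hb
    omega

/-- Injectivity of the sum of the variables in degree `j` on the algebra of a path of `n` vertices
prolonged by a clique with at least two vertices. -/
theorem cliquePathIndep_injective {k : Type*} [Field k] [CharZero k] {m n : ℕ} (hm : 2 ≤ m)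
    (j : ℕ) (f : Finset ℕ → k) (hn : 4 * j ≤ n + 1)
    (hf : ∀ T ⊆ Finset.range (n + m), CliquePathIndep n T → T.card = j + 1 →
      ∑ S ∈ T.powersetCard j, f S = 0) :
    ∀ S ⊆ Finset.range (n + m), CliquePathIndep n S → S.card = j → f S = 0 := by
  intro S hSn hS hSj
  obtain _ | i := j
  · rw [Finset.card_eq_zero] at hSj
    subst hSj
    have := hf {0} (by simp; omega) (by intro a ha b hb; simp_all) (by simp)
    simpa using this
  have hmem : ∀ {T : Finset ℕ} {b a : ℕ}, T ⊆ Finset.range b → b ≤ a → a ∉ T := by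
    intro T b a hT hab ha
    have := Finset.mem_range.1 (hT ha)
    omega
  -- A clique vertex p > n has no neighbour below n, so N = n is allowed; the vertex n is adjacent
  -- to n - 1 and needs N = n - 1.
  have h1 : ∀ N p, N ≤ n → N < p → p < n + m → ∀ T ⊆ Finset.range N, PathIndep T →
      T.card = i + 1 → f T + ∑ S ∈ T.powersetCard i, f (insert p S) = 0 := by
    intro N p hN hNp hp T hTN hT hTc
    have hpT : p ∉ T := hmem hTN hNp.le
    have := hf (insert p T) (Finset.insert_subset (Finset.mem_range.2 hp)
      (hTN.trans (Finset.range_mono (by omega)))) (hT.cliquePathIndep_insert hTN hN hNp)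
      (by rw [Finset.card_insert_of_notMem hpT, hTc])
    have hself : ∑ S ∈ T.powersetCard (i + 1), f S = f T := by
      rw [← hTc, Finset.powersetCard_self, Finset.sum_singleton]
    rwa [sum_powersetCard_insert hpT, hself] at this
  -- The averaging used for paths yields the condition for the square of the sum on the n path
  -- vertices, and 4(i + 1) ≤ n + 1 is exactly the path bound for exponent 2.
  have ha : ∀ p, n < p → p < n + m → ∀ S ⊆ Finset.range n, PathIndep S → S.card = i →
      f (insert p S) = 0 := by
    intro p hnp hp
    refine pathIndep_injective n i 2 (fun S => f (insert p S)) (by omega) (by omega) ?_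
    intro T hTn hT hTc
    have hz : ∑ T' ∈ T.powersetCard (i + 1), (∑ S ∈ T'.powersetCard (i + 1), f S +
        ∑ S ∈ T'.powersetCard i, f (insert p S)) = 0 := by
      refine Finset.sum_eq_zero fun T' hT' => ?_
      rw [Finset.mem_powersetCard] at hT'
      have := h1 n p le_rfl hnp hp T' (hT'.1.trans hTn) (hT.mono hT'.1) hT'.2
      have hself : ∑ S ∈ T'.powersetCard (i + 1), f S = f T' := by
        rw [← hT'.2, Finset.powersetCard_self, Finset.sum_singleton]
      rwa [hself]
    rw [Finset.sum_add_distrib, sum_powersetCard_sum_powersetCard T _ _ (by omega),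
      sum_powersetCard_sum_powersetCard T _ _ (by omega),
      hf T (hTn.trans (Finset.range_mono (by omega))) (hT.cliquePathIndep hTn (by omega))
        (by omega), smul_zero, zero_add, nsmul_eq_mul, mul_eq_zero] at hz
    refine hz.resolve_left ?_
    exact Nat.cast_ne_zero.2 (by omega)
  have hc : ∀ S ⊆ Finset.range n, PathIndep S → S.card = i + 1 → f S = 0 := by
    intro T hTn hT hTc
    have := h1 n (n + 1) le_rfl (by omega) (by omega) T hTn hT hTc
    rwa [Finset.sum_eq_zero, add_zero] at this
    intro S hS
    rw [Finset.mem_powersetCard] at hS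
    exact ha (n + 1) (by omega) (by omega) S (hS.1.trans hTn) (hT.mono hS.1) hS.2
  have hb : ∀ S ⊆ Finset.range (n - 1), PathIndep S → S.card = i → f (insert n S) = 0 := by
    refine pathIndep_injective (n - 1) i 1 (fun S => f (insert n S)) le_rfl (by omega) ?_
    intro T hTn hT hTc
    have := h1 (n - 1) n (by omega) (by omega) (by omega) T hTn hT hTc
    rwa [hc T (hTn.trans (Finset.range_mono (by omega))) hT hTc, zero_add] at this
  by_cases hp : ∃ p ∈ S, n ≤ p
  · obtain ⟨p, hpS, hnp⟩ := hp
    have hpN := Finset.mem_range.1 (hSn hpS)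
    have hSn' : ∀ q ∈ S.erase p, q < n ∧ q + 1 ≠ p := by
      intro q hq
      rw [Finset.mem_erase] at hq
      rcases lt_or_gt_of_ne hq.1 with h | h
      · exact (hS q hq.2 p hpS h).symm
      · have := (hS p hpS q hq.2 h).2
        omega
    have hcard : (S.erase p).card = i := by rw [Finset.card_erase_of_mem hpS]; omega
    have hind := hS.pathIndep.mono (Finset.erase_subset p S)
    rw [← Finset.insert_erase hpS]
    obtain rfl | hlt := hnp.eq_or_lt
    · refine hb _ (fun q hq => Finset.mem_range.2 ?_) hind hcard
      have := hSn' q hq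
      omega
    · exact ha p hlt hpN _ (fun q hq => Finset.mem_range.2 (hSn' q hq).1) hind hcard
  · push Not at hp
    exact hc S (fun q hq => Finset.mem_range.2 (hp q hq)) hS.pathIndep hSj

/-- Surjectivity of the sum of the variables from degree `j` on the algebra of a path of `n`
vertices prolonged by a clique with `m` vertices. -/
theorem initialSpan_pow_succ_le_of_clique {k R : Type*} [Field k] [CharZero k] [CommRing R]
    [Algebra k R] (x : ℕ → R) (hx : ∀ i, x i * x i = 0) (hx' : ∀ i, x (i + 1) * x i = 0)
    {m n j : ℕ} (hcl : ∀ p q, n ≤ p → n ≤ q → x p * x q = 0) (hn : 1 ≤ n) (hj : n + 2 ≤ 3 * j)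
    (N : Submodule k R)
    (hN : ∀ g ∈ initialSpan k x (n + m) ^ j, (∑ i ∈ Finset.range (n + m), x i) * g ∈ N) :
    initialSpan k x (n + m) ^ (j + 1) ≤ N := by
  have hmono : ∀ {i : ℕ}, i ≤ n + m → initialSpan k x i ≤ initialSpan k x (n + m) := fun h =>
    Submodule.span_mono (Set.image_mono (Set.Iio_subset_Iio h))
  have hmem : ∀ {i : ℕ}, i < n + m → x i ∈ initialSpan k x (n + m) := fun h =>
    Submodule.subset_span ⟨_, h, rfl⟩
  -- A clique vertex x_p kills the whole clique, so on its multiples the full sum acts as a sum over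
  -- the path, where the path result applies with exponent 1.
  have hclique : ∀ (p i : ℕ), i ≤ n → n ≤ p → i < p → (∀ q, i ≤ q → q < n → x p * x q = 0) →
      p < n + m → i + 2 ≤ 3 * j → Submodule.span k {x p} * initialSpan k x i ^ j ≤ N := by
    intro p i hin hnp hip hpi hpm hij
    rw [span_singleton_mul_le_iff]
    refine initialSpan_pow_le x hx hx' i j 1 _ le_rfl (by omega) ?_
    intro e he g hg
    have h1 := hN (x p * g) (by
      rw [← he, pow_succ']
      exact Submodule.mul_mem_mul (hmem hpm) (pow_le_pow_left' (hmono (by omega)) _ hg))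
    have h2 : x p * ∑ q ∈ Finset.range (n + m), x q = x p * ∑ q ∈ Finset.range i, x q := by
      rw [Finset.mul_sum, Finset.mul_sum]
      refine (Finset.sum_subset (Finset.range_mono (by omega)) fun q _ hq => ?_).symm
      rw [Finset.mem_range, not_lt] at hq
      by_cases hqn : q < n
      · exact hpi q hq hqn
      · exact hcl p q hnp (by omega)
    rw [Submodule.mem_comap, LinearMap.mulLeft_apply, pow_one, ← mul_assoc, ← h2]
    convert h1 using 1
    ring
  have hp : ∀ r < m, Submodule.span k {x (n + r)} * initialSpan k x (n + r) ^ j ≤ N := by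
    intro r hr
    have hred : ∀ t ≤ r, Submodule.span k {x (n + r)} * initialSpan k x (n + t) ^ j ≤
        Submodule.span k {x (n + r)} * initialSpan k x n ^ j := by
      intro t
      induction t with
      | zero => intro _; exact le_rfl
      | succ t iht =>
        intro ht
        exact (mul_initialSpan_pow_le x (hcl (n + r) (n + t) (by omega) (by omega)) j).trans (iht (by omega))
    refine (hred r le_rfl).trans ?_
    -- The clique vertex n also kills its path neighbour n - 1, so its path segment is one vertex
    -- shorter.
    obtain rfl | hr0 := Nat.eq_zero_or_pos r
    · obtain ⟨l, rfl⟩ : ∃ l, n = l + 1 := ⟨n - 1, by omega⟩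
      refine (mul_initialSpan_pow_le x (hx' l) j).trans
        (hclique (l + 1) l (by omega) le_rfl (by omega) (fun q h1 h2 => ?_) (by omega) (by omega))
      obtain rfl : q = l := by omega
      exact hx' q
    · exact hclique (n + r) n le_rfl (by omega) (by omega) (fun q h1 h2 => by omega) (by omega)
        (by omega)
  have hind : ∀ r ≤ m, initialSpan k x (n + r) ^ (j + 1) ≤ N := by
    intro r
    induction r with
    | zero =>
      intro _
      refine initialSpan_pow_le x hx hx' n (j + 1) 1 N le_rfl (by omega) fun e he g hg => ?_
      obtain rfl : e = j := by omega
      have h1 := hN g (pow_le_pow_left' (hmono (by omega)) _ hg)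
      rw [Finset.sum_range_add, add_mul, Finset.sum_mul (Finset.range m)] at h1
      rw [pow_one]
      refine (N.add_mem_iff_left (sum_mem fun r hr => ?_)).1 h1
      rw [Finset.mem_range] at hr
      refine hp r hr (Submodule.mul_mem_mul (Submodule.mem_span_singleton_self _) ?_)
      exact pow_le_pow_left' (Submodule.span_mono (Set.image_mono
        (Set.Iio_subset_Iio (by omega)))) _ hg
    | succ r ihr =>
      intro hr
      rw [← add_assoc, initialSpan_succ]
      exact (sup_span_singleton_pow_succ_le _ (hx _) j).trans
        (sup_le (ihr (by omega)) (hp r (by omega)))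
  exact hind m le_rfl

/-! ### Transfer to graph algebras through a labelling of the vertices. -/

theorem sum_powersetCard_eq_sum_erase {α M : Type*} [DecidableEq α] [AddCommMonoid M]
    {T : Finset α} {j : ℕ} (hT : T.card = j + 1) (f : Finset α → M) :
    ∑ S ∈ T.powersetCard j, f S = ∑ a ∈ T, f (T.erase a) := by
  symm
  refine Finset.sum_bij (fun a _ => T.erase a) ?_ ?_ ?_ (fun _ _ => rfl)
  · intro a ha
    rw [Finset.mem_powersetCard, Finset.card_erase_of_mem ha]
    exact ⟨Finset.erase_subset _ _, by omega⟩
  · intro a ha b hb hab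
    exact Finset.erase_injOn T ha hb hab
  · intro S hS
    rw [Finset.mem_powersetCard] at hS
    have hc : (T \ S).card = 1 := by rw [Finset.card_sdiff_of_subset hS.1]; omega
    obtain ⟨a, ha⟩ := Finset.card_eq_one.1 hc
    have haT : a ∈ T \ S := by rw [ha]; simp
    refine ⟨a, (Finset.mem_sdiff.1 haT).1, ?_⟩
    rw [← Finset.sdiff_singleton_eq_erase, ← ha, Finset.sdiff_sdiff_eq_self hS.1]

namespace GraphAlgebra

variable (k : Type*) {V : Type*} [Field k] (G : SimpleGraph V) [Fintype V]

/-- The sum of the variables. -/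
noncomputable def sumVar : grading k G 1 :=
  ⟨∑ v, var k G v, sum_mem fun v _ => var_mem k v⟩

variable {G}

/-- A criterion for injectivity in terms of a labelling of the vertices by an initial segment of
the natural numbers. -/
theorem injective_sumVar_of_labelling {pos : V → ℕ} (hpos : Function.Injective pos) {N : ℕ}
    (hN : ∀ i, i < N ↔ ∃ v, pos v = i) {j : ℕ}
    (h : ∀ f : Finset ℕ → k, (∀ T ⊆ Finset.range N, G.IsIndepSet (pos ⁻¹' T) → T.card = j + 1 →
        ∑ S ∈ T.powersetCard j, f S = 0) →
      ∀ S ⊆ Finset.range N, G.IsIndepSet (pos ⁻¹' S) → S.card = j → f S = 0) :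
    Function.Injective (gradedMulMap (grading k G) (sumVar k G) j) := by
  classical
  rw [injective_iff_map_eq_zero]
  rintro ⟨_, p, hp, rfl⟩ h0
  refine Subtype.ext (Ideal.Quotient.eq_zero_iff_mem.2 ((mem_graphIdeal_iff G p).2 ?_))
  have hmem : (∑ v, C (1 : k) * X v) * p ∈ graphIdeal k G := by
    refine Ideal.Quotient.eq_zero_iff_mem.1 ?_
    have h1 : (∑ v, var k G v) * Ideal.Quotient.mkₐ k (graphIdeal k G) p = 0 :=
      congrArg Subtype.val h0
    have := sum_smul_var k (G := G) (fun _ => (1 : k))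
    simp only [one_smul] at this
    rw [this, ← map_mul] at h1
    exact h1
  set pull : Finset ℕ → Finset V := fun S => Finset.univ.filter fun v => pos v ∈ S with hpull
  have hpullc : ∀ S, (pull S : Set V) = pos ⁻¹' S := by
    intro S
    ext v
    simp [hpull]
  have hf := h (fun S => coeff (squarefreeExponent (pull S)) p) ?_
  · intro S hS
    have hSS : pull (S.image pos) = S := by
      ext v
      simp [hpull, hpos.eq_iff]
    by_cases hc : S.card = j
    · have := hf (S.image pos) ?_ ?_ ?_
      · rwa [hSS] at this
      · intro i hi
        obtain ⟨v, -, rfl⟩ := Finset.mem_image.1 hi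
        exact Finset.mem_range.2 ((hN _).2 ⟨v, rfl⟩)
      · rwa [← hpullc, hSS]
      · rw [Finset.card_image_of_injective _ hpos, hc]
    · by_contra hne
      refine hc ?_
      rw [← squarefreeExponent_degree S, Finsupp.degree_eq_weight_one]
      exact hp hne
  · intro T hTN hT hTc
    have h1 := (mem_graphIdeal_iff G _).1 hmem (pull T) (by rwa [hpullc])
    rw [coeff_sum_mul_squarefreeExponent (fun _ => (1 : k))] at h1
    rw [sum_powersetCard_eq_sum_erase hTc, ← h1]
    symm
    refine Finset.sum_bij (fun v _ => pos v) ?_ (fun u _ v _ huv => hpos huv) ?_ ?_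
    · intro v hv
      exact (Finset.mem_filter.1 hv).2
    · intro i hi
      obtain ⟨v, rfl⟩ := (hN i).1 (Finset.mem_range.1 (hTN hi))
      exact ⟨v, Finset.mem_filter.2 ⟨Finset.mem_univ v, hi⟩, rfl⟩
    · intro v _
      rw [one_mul]
      congr 2
      ext u
      simp [hpull, hpos.eq_iff]

/-- A criterion for surjectivity in terms of a labelling of the vertices by an initial segment of
the natural numbers. -/
theorem surjective_sumVar_of_labelling {pos : V → ℕ} (hpos : Function.Injective pos) {N : ℕ}
    (hN : ∀ i, i < N ↔ ∃ v, pos v = i) {j : ℕ}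
    (h : ∀ x : ℕ → GraphAlgebra k G, (∀ i, x i * x i = 0) →
      (∀ a b, (∀ u v, pos u = a → pos v = b → G.Adj u v) → x a * x b = 0) →
      ∀ M : Submodule k (GraphAlgebra k G),
        (∀ g ∈ initialSpan k x N ^ j, (∑ i ∈ Finset.range N, x i) * g ∈ M) →
        initialSpan k x N ^ (j + 1) ≤ M) :
    Function.Surjective (gradedMulMap (grading k G) (sumVar k G) j) := by
  classical
  -- Unused labels go to zero, so the relations hold for all natural indices.
  set x : ℕ → GraphAlgebra k G := Function.extend pos (var k G) 0 with hx
  have hx1 : ∀ v, x (pos v) = var k G v := fun v => hpos.extend_apply _ _ _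
  have hx0 : ∀ i, (¬ ∃ v, pos v = i) → x i = 0 := fun i hi => Function.extend_apply' _ _ _ hi
  have hspan : initialSpan k x N = grading k G 1 := by
    rw [grading_one, initialSpan]
    congr 1
    ext y
    constructor
    · rintro ⟨i, hi, rfl⟩
      obtain ⟨v, rfl⟩ := (hN i).1 hi
      exact ⟨v, (hx1 v).symm⟩
    · rintro ⟨v, rfl⟩
      exact ⟨pos v, (hN _).2 ⟨v, rfl⟩, hx1 v⟩
  have hsum : ∑ i ∈ Finset.range N, x i = ∑ v, var k G v := by
    symm
    refine Finset.sum_bij (fun v _ => pos v) ?_ (fun u _ v _ huv => hpos huv) ?_ ?_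
    · intro v _
      exact Finset.mem_range.2 ((hN _).2 ⟨v, rfl⟩)
    · intro i hi
      obtain ⟨v, rfl⟩ := (hN i).1 (Finset.mem_range.1 hi)
      exact ⟨v, Finset.mem_univ v, rfl⟩
    · intro v _
      exact (hx1 v).symm
  have key := h x ?_ ?_
    ((grading k G j).map (LinearMap.mulLeft k (sumVar k G : GraphAlgebra k G))) ?_
  · rintro ⟨y, hy⟩
    rw [grading_eq_pow, ← hspan] at hy
    obtain ⟨g, hg, hgy⟩ := key hy
    exact ⟨⟨g, hg⟩, Subtype.ext hgy⟩
  · intro i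
    by_cases hi : ∃ v, pos v = i
    · obtain ⟨v, rfl⟩ := hi
      rw [hx1, var_mul_self]
    · rw [hx0 i hi, mul_zero]
  · intro a b hab
    by_cases ha : ∃ v, pos v = a
    · by_cases hb : ∃ v, pos v = b
      · obtain ⟨u, rfl⟩ := ha
        obtain ⟨v, rfl⟩ := hb
        rw [hx1, hx1, var_mul_var k (hab u v rfl rfl)]
      · rw [hx0 b hb, mul_zero]
    · rw [hx0 a ha, zero_mul]
  · intro g hg
    rw [hspan, ← grading_eq_pow] at hg
    rw [hsum]
    exact ⟨g, hg, rfl⟩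

end GraphAlgebra

/-! ### The four bounds for the lollipop graph. -/

section Lollipop

variable {m n : ℕ}

/-- The position of a vertex of the lollipop graph, counted from the first vertex of the clique to
the end of the path. -/
def lollipopPlace (v : Fin m ⊕ Fin n) : ℕ := (finSumFinEquiv v : ℕ)

theorem lollipopPlace_injective :
    Function.Injective (lollipopPlace : Fin m ⊕ Fin n → ℕ) :=
  Fin.val_injective.comp finSumFinEquiv.injective

theorem lollipopPlace_lt (v : Fin m ⊕ Fin n) : lollipopPlace v < m + n :=
  (finSumFinEquiv v).2

theorem lollipopPlace_symm (i : Fin (m + n)) : lollipopPlace (finSumFinEquiv.symm i) = i := by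
  simp [lollipopPlace]

/-- The lollipop is a path on m + n places whose first m places are made a clique; the bridge is a
path edge. Adjacency thereby becomes arithmetic. -/
theorem lollipopGraph_adj (u v : Fin m ⊕ Fin n) : (lollipopGraph m n).Adj u v ↔
    lollipopPlace u ≠ lollipopPlace v ∧ (lollipopPlace u + 1 = lollipopPlace v ∨
      lollipopPlace v + 1 = lollipopPlace u ∨ (lollipopPlace u < m ∧ lollipopPlace v < m)) := by
  rcases u with u | u <;> rcases v with v | v
  · have hu := u.2
    have hv := v.2
    simp [lollipopGraph, lollipopPlace, Fin.ext_iff]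
  · have hu := u.2
    have hv := v.2
    simp [lollipopGraph, lollipopPlace]
    omega
  · have hu := u.2
    have hv := v.2
    simp [lollipopGraph, lollipopPlace]
    omega
  · have hu := u.2
    have hv := v.2
    simp [lollipopGraph, lollipopPlace, SimpleGraph.pathGraph_adj]
    omega

/-- The position of a vertex of the lollipop graph, counted from the end of the path. -/
def lollipopLabel (v : Fin m ⊕ Fin n) : ℕ := n + m - 1 - lollipopPlace v

theorem lollipopLabel_injective : Function.Injective (lollipopLabel : Fin m ⊕ Fin n → ℕ) := by
  intro u v h
  have hu := lollipopPlace_lt u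
  have hv := lollipopPlace_lt v
  refine lollipopPlace_injective ?_
  simp only [lollipopLabel] at h
  omega

theorem lt_iff_exists_lollipopLabel (i : ℕ) :
    i < n + m ↔ ∃ v : Fin m ⊕ Fin n, lollipopLabel v = i := by
  constructor
  · intro h
    refine ⟨finSumFinEquiv.symm ⟨n + m - 1 - i, by omega⟩, ?_⟩
    rw [lollipopLabel, lollipopPlace_symm]
    dsimp only
    omega
  · rintro ⟨v, rfl⟩
    have hv := lollipopPlace_lt v
    rw [lollipopLabel]
    omega

theorem lollipopGraph_adj_iff_label (u v : Fin m ⊕ Fin n) : (lollipopGraph m n).Adj u v ↔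
    lollipopLabel u ≠ lollipopLabel v ∧ (lollipopLabel u + 1 = lollipopLabel v ∨
      lollipopLabel v + 1 = lollipopLabel u ∨ (n ≤ lollipopLabel u ∧ n ≤ lollipopLabel v)) := by
  have hu := lollipopPlace_lt u
  have hv := lollipopPlace_lt v
  rw [lollipopGraph_adj]
  simp only [lollipopLabel]
  omega

theorem isIndepSet_preimage_lollipopLabel {T : Finset ℕ} (hT : T ⊆ Finset.range (n + m)) :
    (lollipopGraph m n).IsIndepSet (lollipopLabel ⁻¹' T) ↔ CliquePathIndep n T := by
  constructor
  · intro h a ha b hb hab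
    obtain ⟨u, rfl⟩ := (lt_iff_exists_lollipopLabel a).1 (Finset.mem_range.1 (hT ha))
    obtain ⟨v, rfl⟩ := (lt_iff_exists_lollipopLabel b).1 (Finset.mem_range.1 (hT hb))
    have : ¬ (lollipopGraph m n).Adj u v := h (x := u) ha (y := v) hb (by rintro rfl; omega)
    rw [lollipopGraph_adj_iff_label] at this
    omega
  · intro h u hu v hv huv
    have hne := lollipopLabel_injective.ne huv
    rw [lollipopGraph_adj_iff_label]
    rcases lt_or_gt_of_ne hne with hlt | hlt
    · have := h _ hu _ hv hlt
      omega
    · have := h _ hv _ hu hlt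
      omega

variable (k : Type*) [Field k]

section

variable [CharZero k] {j : ℕ}

theorem lollipopGraph_injective_of_le_two (hm : m ≤ 2) (hj : 4 * j + 1 ≤ n + m) :
    Function.Injective (gradedMulMap (GraphAlgebra.grading k (lollipopGraph m n))
      (GraphAlgebra.sumVar k _) j) := by
  refine GraphAlgebra.injective_sumVar_of_labelling k lollipopLabel_injective
    lt_iff_exists_lollipopLabel fun f hf S hSN hS hSc => ?_
  rw [isIndepSet_preimage_lollipopLabel hSN] at hS
  refine pathIndep_injective (n + m) j 1 f le_rfl (by omega) (fun T hTN hT hTc => ?_) S hSN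
    hS.pathIndep hSc
  exact hf T hTN ((isIndepSet_preimage_lollipopLabel hTN).2
    (hT.cliquePathIndep hTN (by omega))) hTc

theorem lollipopGraph_injective_of_two_le (hm : 2 ≤ m) (hj : 4 * j ≤ n + 1) :
    Function.Injective (gradedMulMap (GraphAlgebra.grading k (lollipopGraph m n))
      (GraphAlgebra.sumVar k _) j) := by
  refine GraphAlgebra.injective_sumVar_of_labelling k lollipopLabel_injective
    lt_iff_exists_lollipopLabel fun f hf S hSN hS hSc => ?_
  rw [isIndepSet_preimage_lollipopLabel hSN] at hS
  refine cliquePathIndep_injective hm j f hj (fun T hTN hT hTc => ?_) S hSN hS hSc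
  exact hf T hTN ((isIndepSet_preimage_lollipopLabel hTN).2 hT) hTc

theorem lollipopGraph_surjective_of_path (hj : n + m ≤ 3 * j + 1) :
    Function.Surjective (gradedMulMap (GraphAlgebra.grading k (lollipopGraph m n))
      (GraphAlgebra.sumVar k _) j) := by
  refine GraphAlgebra.surjective_sumVar_of_labelling k lollipopLabel_injective
    lt_iff_exists_lollipopLabel fun x hx hadj M hM => ?_
  refine initialSpan_pow_le x hx (fun i => hadj _ _ fun u v hu hv => ?_) (n + m) (j + 1) 1 M le_rfl
    (by omega) fun e he g hg => ?_
  · rw [lollipopGraph_adj_iff_label]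
    omega
  · obtain rfl : e = j := by omega
    rw [pow_one]
    exact hM g hg

theorem lollipopGraph_surjective_of_clique (hn : 1 ≤ n) (hj : n + 2 ≤ 3 * j) :
    Function.Surjective (gradedMulMap (GraphAlgebra.grading k (lollipopGraph m n))
      (GraphAlgebra.sumVar k _) j) := by
  refine GraphAlgebra.surjective_sumVar_of_labelling k lollipopLabel_injective
    lt_iff_exists_lollipopLabel fun x hx hadj M hM => ?_
  refine initialSpan_pow_succ_le_of_clique x hx (fun i => hadj _ _ fun u v hu hv => ?_)
    (fun p q hp hq => ?_) hn hj M hM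
  · rw [lollipopGraph_adj_iff_label]
    omega
  · obtain rfl | hpq := eq_or_ne p q
    · exact hx p
    · refine hadj _ _ fun u v hu hv => ?_
      rw [lollipopGraph_adj_iff_label]
      omega

end

/-- For m ≥ 2 the first clique is all of K_m, since truncated subtraction collapses the places up to
m - 2; for m = 1 it is the bridge. The others are consecutive path edges, possibly a single vertex
or empty at the end. The bound `h₂` makes 2j cliques suffice, and `h₁` makes the last representative
exist. -/
theorem lollipopGraph_not_injective (hm : 1 ≤ m) {j : ℕ} (h₁ : 4 * j + (m - 2) < m + n + 4)
    (h₂ : m + n ≤ 4 * j + (m - 2)) (ℓ : GraphAlgebra.grading k (lollipopGraph m n) 1) :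
    ¬ Function.Injective (gradedMulMap (GraphAlgebra.grading k (lollipopGraph m n)) ℓ j) := by
  refine GraphAlgebra.not_injective_of_clique_cover
    (fun v => (⟨(lollipopPlace v - (m - 2)) / 4, by
        have := lollipopPlace_lt v; omega⟩,
      decide (2 ≤ (lollipopPlace v - (m - 2)) % 4)))
    (fun u v huv hq => ?_)
    (fun i => finSumFinEquiv.symm ⟨4 * i + (m - 2), by have := i.2; omega⟩)
    (fun i => ?_) (fun i i' => ?_) ℓ
  · have hne := lollipopPlace_injective.ne huv
    simp only [Prod.mk.injEq, Fin.mk.injEq, decide_eq_decide] at hq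
    rw [lollipopGraph_adj]
    omega
  · simp only [lollipopPlace_symm, Prod.mk.injEq, Fin.ext_iff, decide_eq_false_iff_not]
    omega
  · rw [lollipopGraph_adj]
    simp only [lollipopPlace_symm]
    omega

/-- The pairs are consecutive places separated by one skipped place. For m ≥ 3 they start at m - 3,
so the first pair lies in the clique and the skipped place m - 1 is the clique end of the bridge. -/
theorem lollipopGraph_not_surjective (hm : 1 ≤ m) {j : ℕ} (h : 3 * j + 2 + (m - 3) ≤ m + n)
    (ℓ : GraphAlgebra.grading k (lollipopGraph m n) 1) :
    ¬ Function.Surjective (gradedMulMap (GraphAlgebra.grading k (lollipopGraph m n)) ℓ j) := by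
  have hb : ∀ b : Bool, b.toNat ≤ 1 := Bool.toNat_le
  have hbi : ∀ a b : Bool, a.toNat = b.toNat → a = b := by decide
  refine GraphAlgebra.not_surjective_of_pairs
    (fun c => finSumFinEquiv.symm ⟨3 * c.1 + c.2.toNat + (m - 3), by
      have := c.1.2; have := hb c.2; omega⟩)
    (fun c c' hcc => ?_) (fun c c' hcc => ?_) ℓ
  · have h1 := hb c.2
    have h2 := hb c'.2
    have := finSumFinEquiv.symm.injective hcc
    rw [Fin.mk.injEq] at this
    refine Prod.ext (Fin.ext (by omega)) (hbi _ _ (by omega))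
  · have h1 := hb c.2
    have h2 := hb c'.2
    have hne := Fin.val_injective.ne hcc
    rw [lollipopGraph_adj]
    simp only [lollipopPlace_symm]
    omega

end Lollipop

/-! ### Comparison of the bounds. -/

theorem theorem5p1 (k : Type*) [Field k] [CharZero k] (m n : ℕ) (hm : 1 ≤ m) (hn : 1 ≤ n) :
    HasWeakLefschetzProperty (GraphAlgebra.grading k (lollipopGraph m n)) ↔
      (m = 1 ∧ n ∈ ({1, 2, 3, 4, 5, 6, 8, 9, 12} : Set ℕ)) ∨
      (m = 2 ∧ n ∈ ({1, 2, 3, 4, 5, 7, 8, 11} : Set ℕ)) ∨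
      (3 ≤ m ∧ n ∈ ({1, 3, 4, 7} : Set ℕ)) := by
  simp only [Set.mem_insert_iff, Set.mem_singleton_iff]
  constructor
  · rintro ⟨ℓ, hℓ⟩
    by_contra hlist
    have hj : ∃ j, 4 * j + (m - 2) < m + n + 4 ∧ m + n ≤ 4 * j + (m - 2) ∧
        3 * j + 2 + (m - 3) ≤ m + n := by
      -- The least j for which 2j cliques suffice. The surjectivity obstruction holds for it as soon
      -- as n ≥ 15, which leaves finitely many n.
      refine ⟨(m + n - (m - 2) + 3) / 4, by omega, by omega, ?_⟩
      by_contra hlt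
      have hn' : n ≤ 14 := by omega
      interval_cases n <;> omega
    obtain ⟨j, h1, h2, h3⟩ := hj
    rcases hℓ j with h | h
    · exact lollipopGraph_not_injective k hm h1 h2 ℓ h
    · exact lollipopGraph_not_surjective k hm h3 ℓ h
  · intro h
    refine ⟨GraphAlgebra.sumVar k _, fun j => ?_⟩
    by_cases hm2 : m ≤ 2
    · have : 4 * j + 1 ≤ n + m ∨ n + m ≤ 3 * j + 1 := by omega
      exact this.imp (lollipopGraph_injective_of_le_two k hm2)
        (lollipopGraph_surjective_of_path k)
    · have : 4 * j ≤ n + 1 ∨ n + 2 ≤ 3 * j := by omega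
      exact this.imp (lollipopGraph_injective_of_two_le k (by omega))
        (lollipopGraph_surjective_of_clique k hn)
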